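/- **Conventions.** Let $\hat{\mathbb C}$ be the Riemann sphere with the spherical (geodesic) distance $\hat\rho$, so that $\operatorname{diam}\hat{\mathbb C}=\pi$; $\|g'(z)\|$ denotes the norm of the derivative in the spherical metric. Let $d,m\ge 1$ be integers and $\Sigma_m=\{1,\dots,m\}^{\mathbb N}$, with shift $\sigma$. For a family of self-maps of $\hat{\mathbb C}$, its Fatou set is the set of points having an open neighbourhood on which the family is normal, and its Julia set is the complement. For a tuple $f=(f_1,\dots,f_m)$ of non-constant rational maps let $G=\langle f_1,\dots,f_m\rangle$ be the semigroup generated under composition, with Fatou set $F(G)$ and Julia set $J(G)$; for a single map $g$ put $J(g)=J(\langle g\rangle)$. Let $\tilde f(\omega,z)=(\sigma\omega,f_{\omega_1}(z))$ on $\Sigma_m\times\hat{\mathbb C}$, let $J_\omega(\tilde f)$ be the Julia set of the family $\{f_{\omega_n}\circ\cdots\circ f_{\omega_1}\}_{n\ge1}$, and let $J(\tilde f)=\overline{\bigcup_{\omega}\{\omega\}\times J_\omega(\tilde f)}$. We write $f\in\mathrm{Exp}(m)$ if $J(G)\ne\emptyset$ and there are $C\in(0,1]$, $\eta>1$ with $\|(f_{\omega_n}\circ\cdots\circ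 f_{\omega_1})'(z)\|\ge C\eta^n$ for all $n\ge1$ and $(\omega,z)\in J(\tilde f)$. **Setting.** Let $U\subset\mathbb C^d$ be a bounded open set and $\lambda_0\in U$. A *holomorphic family with base point $\lambda_0$ and holomorphic conjugacies* over $U$ consists of $f_\lambda=(f_{\lambda,1},\dots,f_{\lambda,m})\in\mathrm{Exp}(m)$, $\lambda\in U$, such that $\lambda\mapsto f_\lambda$ is continuous for the uniform distance, $(z,\lambda)\mapsto f_{\lambda,j}(z)$ is holomorphic on $\hat{\mathbb C}\times U$ for each $j$, and of homeomorphisms $h_\lambda:J(\tilde f_{\lambda_0})\to J(\tilde f_\lambda)$ of the form $h_\lambda(\omega,z)=(\omega,\bar h_\lambda(\omega,z))$ with $h_{\lambda_0}=\mathrm{Id}$ and $h_\lambda\circ\tilde f_{\lambda_0}=\tilde f_\lambda\circ h_\lambda$ on $J(\tilde f_{\lambda_0})$, such that $(\omega,z,\lambda)\mapsto\bar h_\lambda(\omega,z)$ is continuous on $J(\tilde f_{\lambda_0})\times U$ and $\lambda\mapsto\bar h_\lambda(\omega,z)$ is holomorphic on $U$ for each $(\omega,z)\in J(\tilde f_{\lambda_0})$.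 Let $G_\lambda=\langle f_{\lambda,1},\dots,f_{\lambda,m}\rangle$. Such a family over $U$ satisfies * the **transversality condition (TC)** if there is $C>0$ such that for all $r\in(0,\operatorname{diam}\hat{\mathbb C})$ and all $(\omega,z),(\omega',z')\in J(\tilde f_{\lambda_0})$ with $\omega_1\ne\omega_1'$, $\ \mathrm{Leb}_{2d}(\{\lambda\in U:\hat\rho(\bar h_\lambda(\omega,z),\bar h_\lambda(\omega',z'))\le r\})\le Cr^2$; * the **strong transversality condition (STC)** if there is $C>0$ such that for the same $r,(\omega,z),(\omega',z')$, $\ N_r(\{\lambda\in U:\hat\rho(\bar h_\lambda(\omega,z),\bar h_\lambda(\omega',z'))\le r\})\le Cr^{2-2d}$, where $N_r(F)$ is the minimal number of Euclidean balls of radius $r$ in $\mathbb C^d=\mathbb R^{2d}$ needed to cover $F$; * the **analytic transversality condition (ATC)** if $J(G_\lambda)\subset\mathbb C$ for each $\lambda\in U$, and for all $(\omega,z),(\omega',z')\in J(\tilde f_{\lambda_0})$ with $\omega_1\neq\omega_1'$ and all $\lambda\in U$, the function $g(\lambda)=\bar h_\lambda(\omega,z)-\bar h_\lambda(\omega',z')$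 satisfies: if $g(\lambda)=0$, then $\nabla_\lambda g(\lambda)=(\partial g/\partial\lambda_1,\dots,\partial g/\partial\lambda_d)(\lambda)\ne0$. **Lemma.** Let $\{f_\lambda\}_{\lambda\in U}$, $\lambda_0$, $\{h_\lambda\}_{\lambda\in U}$ be as in the Setting, and suppose $J(G_\lambda)\subset\mathbb C$ for each $\lambda\in U$. Write $f_j=f_{\lambda_0,j}$, $G=G_{\lambda_0}$. Suppose that: 1. for each $(i,j)$ with $i\ne j$ and $f_i^{-1}(J(G))\cap f_j^{-1}(J(G))\ne\emptyset$ there is $\alpha_{ij}\in\{1,\dots,m\}$ with $f_i\big(f_i^{-1}(J(G))\cap f_j^{-1}(J(G))\big)\subset J(f_{\alpha_{ij}})$; 2. if $i,j,k$ are mutually distinct, then $f_k\big(f_i^{-1}(J(G))\cap f_j^{-1}(J(G))\big)\subset F(G)$; 3. for each $(j,k)$ with $j\ne k$, $f_k(J(f_j))\subset F(G)$; 4. if $i\ne j$ and $z\in f_i^{-1}(J(G))\cap f_j^{-1}(J(G))$, then $\nabla_\lambda\big(\bar h_\lambda(i\alpha_{ij}^\infty,z)-\bar h_\lambda(j\alpha_{ji}^\infty,z)\big)\big|_{\lambda=\lambda_0}\ne0$,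 where $ik^\infty=(i,k,k,k,\dots)$. (By 1–3, $(i\alpha_{ij}^\infty,z)$ and $(j\alpha_{ji}^\infty,z)$ lie in $J(\tilde f_{\lambda_0})$.) Then there is an open neighbourhood $U_0\subset U$ of $\lambda_0$ such that the restricted family $\{f_\lambda\}_{\lambda\in U_0}$, with base point $\lambda_0$ and the conjugacies $\{h_\lambda\}_{\lambda\in U_0}$, satisfies ATC, STC and TC. -/

import Mathlib

namespace RationalSemigroup

open Set Filter Topology MeasureTheory
open scoped OnePoint

noncomputable section

/-! ## The Riemann sphere -/

/-- The Riemann sphere, with Mathlib's topology of the one-point compactification. -/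
abbrev Sphere : Type := OnePoint ℂ

/-- The affine coordinate of a finite point; it is only used at points different from `∞`. -/
def toC (z : Sphere) : ℂ := z.elim 0 id

/-- The involution `z ↦ 1/z` of the sphere, exchanging `0` and `∞`. -/
def invS : Sphere → Sphere
  | ∞ => ((0 : ℂ) : Sphere)
  | OnePoint.some z => open Classical in if z = 0 then ∞ else ((z⁻¹ : ℂ) : Sphere)

/-- Half of the chordal distance, i.e. the sine of half of the angle between two points of the
unit sphere. -/
def halfChord : Sphere → Sphere → ℝ
  | ∞, ∞ => 0
  | ∞, OnePoint.some w => 1 / √(1 + ‖w‖ ^ 2)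
  | OnePoint.some z, ∞ => 1 / √(1 + ‖z‖ ^ 2)
  | OnePoint.some z, OnePoint.some w => ‖z - w‖ / (√(1 + ‖z‖ ^ 2) * √(1 + ‖w‖ ^ 2))

/-- The spherical distance: the geodesic distance of the metric `2 |dz| / (1 + |z|²)`. -/
def sphDist (z w : Sphere) : ℝ := 2 * Real.arcsin (halfChord z w)

/-- The diameter of the sphere for the spherical distance. -/
def sphereDiam : ℝ := sSup (range fun x : Sphere × Sphere => sphDist x.1 x.2)

theorem sphereDiam_eq : sphereDiam = Real.pi := by
  have hle : ∀ x : Sphere × Sphere, sphDist x.1 x.2 ≤ Real.pi := fun x => by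
    have := Real.arcsin_le_pi_div_two (halfChord x.1 x.2)
    unfold sphDist
    linarith
  have hmax : sphDist ((0 : ℂ) : Sphere) ∞ = Real.pi := by
    have h : halfChord ((0 : ℂ) : Sphere) ∞ = 1 := by
      change 1 / √(1 + ‖(0 : ℂ)‖ ^ 2) = 1
      simp
    unfold sphDist
    rw [h, Real.arcsin_one]
    ring
  refine le_antisymm (csSup_le (range_nonempty _) ?_) ?_
  · rintro _ ⟨x, rfl⟩
    exact hle x
  · refine le_csSup ⟨Real.pi, ?_⟩ ⟨(((0 : ℂ) : Sphere), ∞), hmax⟩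
    rintro _ ⟨x, rfl⟩
    exact hle x

/-- A sphere-valued map is holomorphic at `x` if near `x` it is given by an analytic function in one
of the two standard charts `z` and `1/z`. -/
def SphHolomorphicAt {E : Type*} [NormedAddCommGroup E] [NormedSpace ℂ E]
    (g : E → Sphere) (x : E) : Prop :=
  ∃ φ : E → ℂ, AnalyticAt ℂ φ x ∧
    ((∀ᶠ y in 𝓝 x, g y = (φ y : Sphere)) ∨ (∀ᶠ y in 𝓝 x, g y = invS (φ y : Sphere)))

/-- The norm of the derivative of `g` at `z` with respect to the spherical metric. It is computed in
the chart `z` at finite points and in the chart `1/z` at `∞`, in the source and in the target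
(`1/z` is an isometry). -/
def sphDeriv (g : Sphere → Sphere) (z : Sphere) : ℝ :=
  open Classical in
  let G : ℂ → Sphere := fun w => if z = ∞ then g (invS (w : Sphere)) else g (w : Sphere)
  let a : ℂ := if z = ∞ then 0 else toC z
  let H : ℂ → ℂ := fun w => if g z = ∞ then toC (invS (G w)) else toC (G w)
  ‖deriv H a‖ * (1 + ‖a‖ ^ 2) / (1 + ‖H a‖ ^ 2)

/-- The self-map of the sphere induced by the fraction `p / q` (for coprime `p`, `q`). -/
def ratEval (p q : Polynomial ℂ) : Sphere → Sphere
  | ∞ => open Classical in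
      if q.natDegree < p.natDegree then ∞
      else ((p.coeff q.natDegree / q.leadingCoeff : ℂ) : Sphere)
  | OnePoint.some z => open Classical in
      if q.eval z = 0 then ∞ else ((p.eval z / q.eval z : ℂ) : Sphere)

/-- Non-constant rational maps of the sphere. -/
def IsNonconstRational (g : Sphere → Sphere) : Prop :=
  ∃ p q : Polynomial ℂ, IsCoprime p q ∧ 0 < max p.natDegree q.natDegree ∧ g = ratEval p q

/-! ## Fatou and Julia sets -/

/-- Normality on `V` (open): every sequence in the family has a subsequence that converges uniformly
on compact subsets of `V`, for the spherical distance. -/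
def NormalOn (F : Set (Sphere → Sphere)) (V : Set Sphere) : Prop :=
  ∀ u : ℕ → Sphere → Sphere, (∀ n, u n ∈ F) →
    ∃ φ : ℕ → ℕ, StrictMono φ ∧ ∃ g : Sphere → Sphere,
      ∀ K ⊆ V, IsCompact K → ∀ ε > 0, ∀ᶠ n in atTop, ∀ z ∈ K, sphDist (u (φ n) z) (g z) < ε

/-- The points having an open neighbourhood on which the family is normal. -/
def fatouSet (F : Set (Sphere → Sphere)) : Set Sphere :=
  {z | ∃ V : Set Sphere, IsOpen V ∧ z ∈ V ∧ NormalOn F V}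

def juliaSet (F : Set (Sphere → Sphere)) : Set Sphere := (fatouSet F)ᶜ

/-- The semigroup generated by `S` under composition: all compositions of `n ≥ 1` elements
of `S`. -/
def semigroupGen (S : Set (Sphere → Sphere)) : Set (Sphere → Sphere) :=
  {g | ∃ l : List (Sphere → Sphere), l ≠ [] ∧ (∀ h ∈ l, h ∈ S) ∧ g = l.foldr (fun a b => a ∘ b) id}

/-- The semigroup `⟨f_1, …, f_m⟩`. -/
def semigroupOf {m : ℕ} (f : Fin m → Sphere → Sphere) : Set (Sphere → Sphere) :=
  semigroupGen (range f)

/-- The Julia set `J(g) = J(⟨g⟩)` of a single map. -/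
def juliaSingle (g : Sphere → Sphere) : Set Sphere := juliaSet (semigroupGen {g})

/-! ## The skew product -/

/-- `f_{ω_n} ∘ ⋯ ∘ f_{ω_1}`; the letter `ω_k` is `ω (k - 1)`. -/
def wordMap {m : ℕ} (f : Fin m → Sphere → Sphere) (ω : ℕ → Fin m) : ℕ → Sphere → Sphere
  | 0 => id
  | n + 1 => f (ω n) ∘ wordMap f ω n

/-- The skew product map `(ω, z) ↦ (σ ω, f_{ω_1} z)`. -/
def skewMap {m : ℕ} (f : Fin m → Sphere → Sphere) (x : (ℕ → Fin m) × Sphere) :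
    (ℕ → Fin m) × Sphere :=
  (fun n => x.1 (n + 1), f (x.1 0) x.2)

/-- The fibre Julia set `J_ω`. -/
def fibreJulia {m : ℕ} (f : Fin m → Sphere → Sphere) (ω : ℕ → Fin m) : Set Sphere :=
  juliaSet {g | ∃ n : ℕ, 1 ≤ n ∧ g = wordMap f ω n}

/-- The Julia set of the skew product map. -/
def skewJulia {m : ℕ} (f : Fin m → Sphere → Sphere) : Set ((ℕ → Fin m) × Sphere) :=
  closure {x | x.2 ∈ fibreJulia f x.1}

/-- The expanding condition; `‖(wordMap f ω n)' (z)‖` is the norm of the derivative of the `n`-th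
iterate of the skew product along the fibre. -/
def IsExpanding {m : ℕ} (f : Fin m → Sphere → Sphere) : Prop :=
  (juliaSet (semigroupOf f)).Nonempty ∧
    ∃ C η : ℝ, 0 < C ∧ C ≤ 1 ∧ 1 < η ∧
      ∀ n : ℕ, 1 ≤ n → ∀ x ∈ skewJulia f, C * η ^ n ≤ sphDeriv (wordMap f x.1 n) x.2

/-- `Exp(m)`: the `m`-tuples of non-constant rational maps generating an expanding semigroup. -/
def ExpSet (m : ℕ) : Set (Fin m → Sphere → Sphere) :=
  {f | (∀ j, IsNonconstRational (f j)) ∧ IsExpanding f}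

/-! ## Families of multimaps -/

/-- A continuous family in `Exp(m)` over a bounded open set `U`, with base point `p₀` and with
fibred conjugacies `h_p (ω, z) = (ω, hbar p ω z)` from the skew Julia set at `p₀` to the one at
`p`. The values of `hbar` matter only on `U` and on the skew Julia set at `p₀`. -/
structure ConjugacySetting {E : Type*} [NormedAddCommGroup E] {m : ℕ} (U : Set E) (p₀ : E)
    (f : E → Fin m → Sphere → Sphere) (hbar : E → (ℕ → Fin m) → Sphere → Sphere) : Prop where
  isOpen : IsOpen U
  isBounded : Bornology.IsBounded U
  base_mem : p₀ ∈ U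
  mem_exp : ∀ p ∈ U, f p ∈ ExpSet m
  /-- continuity of `p ↦ f_p` for the uniform spherical distance -/
  continuous_family : ∀ p ∈ U, ∀ j, ∀ ε > 0, ∀ᶠ q in 𝓝[U] p, ∀ z, sphDist (f q j z) (f p j z) < ε
  homeo : ∀ p ∈ U, ∃ H : skewJulia (f p₀) ≃ₜ skewJulia (f p),
    ∀ x : skewJulia (f p₀), (H x : (ℕ → Fin m) × Sphere) = (x.1.1, hbar p x.1.1 x.1.2)
  base_eq : ∀ x ∈ skewJulia (f p₀), hbar p₀ x.1 x.2 = x.2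
  conj : ∀ p ∈ U, ∀ x ∈ skewJulia (f p₀),
    hbar p (skewMap (f p₀) x).1 (skewMap (f p₀) x).2 = f p (x.1 0) (hbar p x.1 x.2)
  continuous_hbar : ContinuousOn
    (fun y : ((ℕ → Fin m) × Sphere) × E => hbar y.2 y.1.1 y.1.2) (skewJulia (f p₀) ×ˢ U)

/-- `(z, p) ↦ f_{p,j}(z)` is holomorphic on the product of the sphere and `U`, for each `j`; near
`z = ∞` this is read in the coordinate `1/z`. -/
def HolomorphicFamily {E : Type*} [NormedAddCommGroup E] [NormedSpace ℂ E] {m : ℕ} (U : Set E)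
    (f : E → Fin m → Sphere → Sphere) : Prop :=
  ∀ j, ∀ p ∈ U,
    (∀ a : ℂ, SphHolomorphicAt (fun y : ℂ × E => f y.2 j (y.1 : Sphere)) (a, p)) ∧
    SphHolomorphicAt (fun y : ℂ × E => f y.2 j (invS (y.1 : Sphere))) (0, p)

/-- A holomorphic family in `Exp(m)` with conjugacies depending holomorphically on the
parameter. -/
structure HolomorphicSetting {E : Type*} [NormedAddCommGroup E] [NormedSpace ℂ E] {m : ℕ}
    (U : Set E) (p₀ : E) (f : E → Fin m → Sphere → Sphere)
    (hbar : E → (ℕ → Fin m) → Sphere → Sphere) : Prop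
    extends ConjugacySetting U p₀ f hbar where
  holomorphic_family : HolomorphicFamily U f
  holomorphic_hbar : ∀ x ∈ skewJulia (f p₀), ∀ p ∈ U,
    SphHolomorphicAt (fun q => hbar q x.1 x.2) p

/-! ## Transversality conditions -/

/-- The transversality condition, for a parameter set in a real Euclidean space `E`. -/
def TransversalityCondition {E : Type*} [NormedAddCommGroup E] [MeasureSpace E] {m : ℕ}
    (U : Set E) (p₀ : E) (f : E → Fin m → Sphere → Sphere)
    (hbar : E → (ℕ → Fin m) → Sphere → Sphere) : Prop :=
  ∃ C : ℝ, 0 < C ∧ ∀ r : ℝ, 0 < r → r < sphereDiam →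
    ∀ x ∈ skewJulia (f p₀), ∀ y ∈ skewJulia (f p₀), x.1 0 ≠ y.1 0 →
      volume {p ∈ U | sphDist (hbar p x.1 x.2) (hbar p y.1 y.2) ≤ r} ≤ ENNReal.ofReal (C * r ^ 2)

/-- `N_r(F)`: the minimal number of balls of radius `r` needed to cover `F`. -/
def coverNum {E : Type*} [PseudoMetricSpace E] (r : ℝ) (F : Set E) : ℕ∞ :=
  ⨅ (t : Finset E) (_ : F ⊆ ⋃ c ∈ t, Metric.ball c r), (t.card : ℕ∞)

/-- The strong transversality condition, for a parameter set in a Euclidean space `E` of real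
dimension `D = Module.finrank ℝ E`; the exponent is `2 - D`. -/
def StrongTransversalityCondition {E : Type*} [NormedAddCommGroup E] [NormedSpace ℝ E] {m : ℕ}
    (U : Set E) (p₀ : E) (f : E → Fin m → Sphere → Sphere)
    (hbar : E → (ℕ → Fin m) → Sphere → Sphere) : Prop :=
  ∃ C : ℝ, 0 < C ∧ ∀ r : ℝ, 0 < r → r < sphereDiam →
    ∀ x ∈ skewJulia (f p₀), ∀ y ∈ skewJulia (f p₀), x.1 0 ≠ y.1 0 →
      (coverNum r {p ∈ U | sphDist (hbar p x.1 x.2) (hbar p y.1 y.2) ≤ r} : ENNReal) ≤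
        ENNReal.ofReal (C * r ^ ((2 : ℤ) - (Module.finrank ℝ E : ℤ)))

/-- The complex gradient `(∂g/∂λ_1, …, ∂g/∂λ_d)` at `p`. -/
def grad {d : ℕ} (g : EuclideanSpace ℂ (Fin d) → ℂ) (p : EuclideanSpace ℂ (Fin d)) : Fin d → ℂ :=
  fun k => fderiv ℂ g p (EuclideanSpace.single k 1)

/-- `p ↦ hbar_p(ω, z) - hbar_p(ω', z')`, for `x = (ω, z)` and `y = (ω', z')`. It is used where the
values of `hbar` are finite. -/
def hDiff {E : Type*} {m : ℕ} (hbar : E → (ℕ → Fin m) → Sphere → Sphere)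
    (x y : (ℕ → Fin m) × Sphere) (p : E) : ℂ :=
  toC (hbar p x.1 x.2) - toC (hbar p y.1 y.2)

/-- The analytic transversality condition. -/
structure AnalyticTransversalityCondition {d m : ℕ} (U : Set (EuclideanSpace ℂ (Fin d)))
    (p₀ : EuclideanSpace ℂ (Fin d)) (f : EuclideanSpace ℂ (Fin d) → Fin m → Sphere → Sphere)
    (hbar : EuclideanSpace ℂ (Fin d) → (ℕ → Fin m) → Sphere → Sphere) : Prop where
  finite : ∀ p ∈ U, ∞ ∉ juliaSet (semigroupOf (f p))
  transversal : ∀ x ∈ skewJulia (f p₀), ∀ y ∈ skewJulia (f p₀), ∀ p ∈ U,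
    hDiff hbar x y p = 0 → x.1 0 ≠ y.1 0 → grad (hDiff hbar x y) p ≠ 0

/-- The overlap `f_i⁻¹(J(G)) ∩ f_j⁻¹(J(G))`. -/
def overlap {m : ℕ} (f : Fin m → Sphere → Sphere) (i j : Fin m) : Set Sphere :=
  f i ⁻¹' juliaSet (semigroupOf f) ∩ f j ⁻¹' juliaSet (semigroupOf f)

/-- The sequence `i k^∞ = (i, k, k, k, …)`. -/
def consConst {m : ℕ} (i k : Fin m) : ℕ → Fin m
  | 0 => i
  | _ + 1 => k

end

end RationalSemigroup

open RationalSemigroup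

/-!
Two points `(ω, z)`, `(ω', z')` of the skew Julia set at the base parameter with `ω₁ ≠ ω'₁` can
have equal images under the conjugacy at the base parameter only if `z = z'`, and then `z` lies in
the overlap of the preimages of the Julia set under `f_i` and `f_j`, where `i = ω₁`, `j = ω'₁`. Hence
`f_i z` lies in the Julia set of the single map `f_α`, where `α = α i j`. That set is forward
invariant under `f_α`, and the other generators send it into the Fatou set, so that the itinerary is
forced to be `ω = i α^∞` (`eq_consConst_of_mem_overlap`). The gradient condition therefore says
precisely that all zeros of the functions
`λ ↦ hbar_λ (ω, z) - hbar_λ (ω', z')` at the base parameter are nondegenerate.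

The pairs of such points form a compact set, and these functions of the parameter are holomorphic and
depend continuously on the pair. By the Cauchy estimate their derivatives depend continuously on the
pair too (`exists_ball_eventually_fderiv_sub_le`), so near a given pair and near the base parameter
either the functions are bounded away from zero, or their derivatives are close to a fixed nonzero
linear form `D`. In the second case, replacing a coordinate `k` with `D e_k ≠ 0` by the function `g`
gives a map which contracts distances at most by a constant factor, and which sends `{|g| ≤ c r}` into a
polydisc with one radius of order `r`. Comparing volumes bounds the number of `r`-separated points in
`{|g| ≤ c r}` by a multiple of `r ^ (2 - 2 d)` (`exists_coverNum_le_of_expanding`). Compactness makes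
the bounds uniform (`exists_transversalOn`), which gives the analytic and the strong transversality
condition; the latter implies the transversality condition as balls of radius `r` have volume of order
`r ^ (2 d)`.
-/

namespace RationalSemigroup

open Set Filter Topology MeasureTheory
open scoped OnePoint

/-! ### Continuity on the sphere -/

theorem coe_invS_of_ne {z : ℂ} (hz : z ≠ 0) : invS (z : Sphere) = ((z⁻¹ : ℂ) : Sphere) := by
  change (open Classical in if z = 0 then ∞ else ((z⁻¹ : ℂ) : Sphere)) = _
  rw [if_neg hz]

theorem coe_invS_zero : invS ((0 : ℂ) : Sphere) = ∞ := by
  change (open Classical in if (0 : ℂ) = 0 then ∞ else (((0 : ℂ)⁻¹ : ℂ) : Sphere)) = _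
  rw [if_pos rfl]

theorem toC_coe (z : ℂ) : toC (z : Sphere) = z := rfl

theorem coe_toC {z : Sphere} (hz : z ≠ ∞) : (toC z : Sphere) = z := by
  induction z using OnePoint.rec with
  | infty => exact absurd rfl hz
  | coe z => rfl

theorem continuousAt_toC {z : Sphere} (hz : z ≠ ∞) : ContinuousAt toC z := by
  induction z using OnePoint.rec with
  | infty => exact absurd rfl hz
  | coe z => rw [OnePoint.continuousAt_coe]; exact continuousAt_id

theorem continuous_invS_coe : Continuous fun z : ℂ => invS (z : Sphere) := by
  rw [continuous_iff_continuousAt]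
  intro z
  by_cases hz : z = 0
  · subst hz
    rw [← continuousWithinAt_compl_self, ContinuousWithinAt, coe_invS_zero]
    have h := OnePoint.tendsto_coe_infty (X := ℂ)
    rw [coclosedCompact_eq_cocompact, ← Metric.cobounded_eq_cocompact] at h
    refine (h.comp tendsto_inv₀_nhdsNE_zero).congr' ?_
    filter_upwards [self_mem_nhdsWithin] with w hw
    exact (coe_invS_of_ne hw).symm
  · have h : ContinuousAt (fun w : ℂ => ((w⁻¹ : ℂ) : Sphere)) z :=
      OnePoint.continuous_coe.continuousAt.comp (continuousAt_inv₀ hz)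
    refine h.congr ?_
    filter_upwards [isOpen_ne.mem_nhds hz] with w hw
    exact (coe_invS_of_ne hw).symm

theorem SphHolomorphicAt.continuousAt {E : Type*} [NormedAddCommGroup E] [NormedSpace ℂ E]
    {g : E → Sphere} {x : E} (h : SphHolomorphicAt g x) : ContinuousAt g x := by
  obtain ⟨φ, hφ, h | h⟩ := h
  · exact (OnePoint.continuous_coe.continuousAt.comp hφ.continuousAt).congr
      (h.mono fun _ hy => hy.symm)
  · exact (ContinuousAt.comp (g := fun z : ℂ => invS (z : Sphere))
      continuous_invS_coe.continuousAt hφ.continuousAt).congr (h.mono fun _ hy => hy.symm)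

/-- A sphere-valued holomorphic map which avoids `∞` is analytic in the affine coordinate. -/
theorem SphHolomorphicAt.analyticAt_toC {E : Type*} [NormedAddCommGroup E] [NormedSpace ℂ E]
    {g : E → Sphere} {x : E} (h : SphHolomorphicAt g x) (hx : g x ≠ ∞) :
    AnalyticAt ℂ (fun y => toC (g y)) x := by
  obtain ⟨φ, hφ, h | h⟩ := h
  · refine hφ.congr ?_
    filter_upwards [h] with y hy
    rw [hy, toC_coe]
  · have h0 : φ x ≠ 0 := fun h0 => hx (by rw [h.self_of_nhds, h0, coe_invS_zero])
    refine (hφ.inv h0).congr ?_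
    filter_upwards [h, hφ.continuousAt.eventually_ne h0] with y hy hy0
    rw [hy, coe_invS_of_ne hy0, toC_coe]
    rfl

theorem HolomorphicFamily.continuous {E : Type*} [NormedAddCommGroup E] [NormedSpace ℂ E] {m : ℕ}
    {U : Set E} {f : E → Fin m → Sphere → Sphere} (hf : HolomorphicFamily U f) {p : E}
    (hp : p ∈ U) (j : Fin m) : Continuous (f p j) := by
  rw [continuous_iff_continuousAt]
  intro z
  induction z using OnePoint.rec with
  | infty =>
    have h := ((hf j p hp).2.continuousAt.comp (f := fun z : ℂ => (z, p)) (x := 0)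
      (by fun_prop)).tendsto
    simp only [Function.comp_def, coe_invS_zero] at h
    rw [OnePoint.continuousAt_infty', coclosedCompact_eq_cocompact,
      ← Metric.cobounded_eq_cocompact]
    refine (h.comp tendsto_inv₀_cobounded).congr' ?_
    filter_upwards [(Metric.hasBasis_cobounded_compl_closedBall (0 : ℂ)).mem_of_mem
      (i := (0 : ℝ)) trivial] with w hw
    have hw : w ≠ 0 := fun h => hw (by simp [h])
    simp only [Function.comp_apply]
    rw [coe_invS_of_ne (inv_ne_zero hw), inv_inv]
  | coe z =>
    rw [OnePoint.continuousAt_coe]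
    exact ((hf j p hp).1 z).continuousAt.comp (f := fun z : ℂ => (z, p)) (by fun_prop)

/-! ### Fatou and Julia sets -/

theorem sphDist_self (z : Sphere) : sphDist z z = 0 := by
  have : halfChord z z = 0 := by
    induction z using OnePoint.rec with
    | infty => rfl
    | coe z =>
      change ‖z - z‖ / (√(1 + ‖z‖ ^ 2) * √(1 + ‖z‖ ^ 2)) = 0
      simp
  simp [sphDist, this]

theorem juliaSet_mono {F F' : Set (Sphere → Sphere)} (h : F ⊆ F') : juliaSet F ⊆ juliaSet F' :=
  compl_subset_compl.2 fun _ ⟨V, hV, hz, hn⟩ => ⟨V, hV, hz, fun u hu => hn u fun n => h (hu n)⟩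

theorem isClosed_juliaSet (F : Set (Sphere → Sphere)) : IsClosed (juliaSet F) := by
  refine isClosed_compl_iff.2 (isOpen_iff_mem_nhds.2 ?_)
  rintro z ⟨V, hV, hz, hn⟩
  exact mem_of_superset (hV.mem_nhds hz) fun w hw => ⟨V, hV, hw, hn⟩

/-- Precomposing a normal family with a continuous map `h`, and adjoining `h` itself, leaves it
normal. -/
theorem NormalOn.precomp {F F' : Set (Sphere → Sphere)} {V : Set Sphere} (hn : NormalOn F V)
    {h : Sphere → Sphere} (hh : Continuous h) (hF : ∀ g ∈ F', g = h ∨ ∃ v ∈ F, g = v ∘ h) :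
    NormalOn F' (h ⁻¹' V) := by
  intro u hu
  by_cases hfr : ∃ᶠ n in atTop, u n = h
  · obtain ⟨φ, hφ, hφu⟩ := extraction_of_frequently_atTop hfr
    refine ⟨φ, hφ, h, fun K _ _ ε hε => Eventually.of_forall fun n z _ => ?_⟩
    rw [hφu, sphDist_self]
    exact hε
  · obtain ⟨N, hN⟩ := eventually_atTop.1 (not_frequently.1 hfr)
    have hex : ∀ n, ∃ v ∈ F, u (N + n) = v ∘ h := fun n =>
      (hF _ (hu (N + n))).resolve_left (hN _ (Nat.le_add_right N n))
    choose v hvF hv using hex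
    obtain ⟨φ, hφ, g, hg⟩ := hn v hvF
    refine ⟨fun n => N + φ n, fun a b hab => Nat.add_lt_add_left (hφ hab) N, g ∘ h,
      fun K hK hKc ε hε => ?_⟩
    filter_upwards [hg (h '' K) (image_subset_iff.2 hK) (hKc.image hh) ε hε] with n hn z hz
    rw [hv]
    exact hn _ (mem_image_of_mem h hz)

section Dynamics

variable {m : ℕ} {f : Fin m → Sphere → Sphere}

theorem wordMap_succ' (f : Fin m → Sphere → Sphere) (ω : ℕ → Fin m) (n : ℕ) :
    wordMap f ω (n + 1) = wordMap f (fun k => ω (k + 1)) n ∘ f (ω 0) := by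
  induction n with
  | zero => rfl
  | succ n ih => rw [wordMap, ih]; rfl

theorem wordMap_mem_semigroupGen {S : Set (Sphere → Sphere)} {ω : ℕ → Fin m}
    (hS : ∀ k, f (ω k) ∈ S) {n : ℕ} (hn : 1 ≤ n) : wordMap f ω n ∈ semigroupGen S := by
  have key : ∀ n, ∃ l : List (Sphere → Sphere), l.length = n ∧ (∀ h ∈ l, h ∈ S) ∧
      wordMap f ω n = l.foldr (fun a b => a ∘ b) id := by
    intro n
    induction n with
    | zero => exact ⟨[], rfl, by simp, rfl⟩
    | succ n ih =>
      obtain ⟨l, hl, hlS, hw⟩ := ih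
      refine ⟨f (ω n) :: l, by simp [hl], ?_, by rw [wordMap, hw]; rfl⟩
      rintro h (_ | ⟨_, hh⟩)
      exacts [hS n, hlS h hh]
  obtain ⟨l, hl, hlS, hw⟩ := key n
  exact ⟨l, List.ne_nil_of_length_pos (by omega), hlS, hw⟩

/-- The Julia set of a single map is a fibre Julia set, that of a constant sequence. -/
theorem juliaSingle_eq_fibreJulia (f : Fin m → Sphere → Sphere) (k : Fin m) :
    juliaSingle (f k) = fibreJulia f fun _ => k := by
  have key : ∀ l : List (Sphere → Sphere), (∀ h ∈ l, h = f k) →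
      l.foldr (fun a b => a ∘ b) id = wordMap f (fun _ => k) l.length := by
    intro l
    induction l with
    | nil => intro _; rfl
    | cons a l ih =>
      intro h
      rw [List.foldr_cons, ih fun g hg => h g (List.mem_cons_of_mem a hg),
        h a List.mem_cons_self]
      rfl
  refine congrArg juliaSet (Subset.antisymm ?_ ?_)
  · rintro g ⟨l, hl, hlS, rfl⟩
    exact ⟨l.length, List.length_pos_iff.2 hl, key l hlS⟩
  · rintro g ⟨n, hn, rfl⟩
    exact wordMap_mem_semigroupGen (fun _ => mem_singleton (f k)) hn

theorem fibreJulia_subset (f : Fin m → Sphere → Sphere) (ω : ℕ → Fin m) :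
    fibreJulia f ω ⊆ juliaSet (semigroupOf f) := by
  refine juliaSet_mono ?_
  rintro g ⟨n, hn, rfl⟩
  exact wordMap_mem_semigroupGen (fun k => mem_range_self (ω k)) hn

theorem snd_mem_juliaSet_of_mem_skewJulia {x : (ℕ → Fin m) × Sphere} (hx : x ∈ skewJulia f) :
    x.2 ∈ juliaSet (semigroupOf f) :=
  closure_minimal (t := Prod.snd ⁻¹' juliaSet (semigroupOf f))
    (fun y hy => fibreJulia_subset f y.1 hy)
    ((isClosed_juliaSet _).preimage continuous_snd) hx

theorem map_mem_fibreJulia {ω : ℕ → Fin m} (hf : Continuous (f (ω 0))) {z : Sphere}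
    (hz : z ∈ fibreJulia f ω) : f (ω 0) z ∈ fibreJulia f fun n => ω (n + 1) := by
  rintro ⟨V, hV, hzV, hn⟩
  refine hz ⟨f (ω 0) ⁻¹' V, hV.preimage hf, hzV, hn.precomp hf ?_⟩
  rintro g ⟨n, hn, rfl⟩
  obtain ⟨n, rfl⟩ := Nat.exists_eq_add_of_le' hn
  rcases Nat.eq_zero_or_pos n with rfl | hpos
  · exact Or.inl rfl
  · exact Or.inr ⟨_, ⟨n, hpos, rfl⟩, wordMap_succ' f ω n⟩

theorem continuous_skewMap (hf : ∀ j, Continuous (f j)) : Continuous (skewMap f) := by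
  have h1 : Continuous fun y : Fin m × Sphere => f y.1 y.2 :=
    continuous_prod_of_discrete_left.2 hf
  unfold skewMap
  refine Continuous.prodMk (by fun_prop)
    (h1.comp (g := fun y : Fin m × Sphere => f y.1 y.2) (f := fun x : (ℕ → Fin m) × Sphere =>
      (x.1 0, x.2)) (by fun_prop))

theorem skewMap_mem_skewJulia (hf : ∀ j, Continuous (f j)) {x : (ℕ → Fin m) × Sphere}
    (hx : x ∈ skewJulia f) : skewMap f x ∈ skewJulia f :=
  map_mem_closure (continuous_skewMap hf) hx fun _ hy => map_mem_fibreJulia (hf _) hy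

theorem map_juliaSingle (hf : ∀ j, Continuous (f j)) {k : Fin m} {z : Sphere}
    (hz : z ∈ juliaSingle (f k)) : f k z ∈ juliaSingle (f k) := by
  rw [juliaSingle_eq_fibreJulia] at hz ⊢
  exact map_mem_fibreJulia (ω := fun _ => k) (hf k) hz

theorem apply_mem_juliaSet (hf : ∀ j, Continuous (f j)) {x : (ℕ → Fin m) × Sphere}
    (hx : x ∈ skewJulia f) : f (x.1 0) x.2 ∈ juliaSet (semigroupOf f) :=
  snd_mem_juliaSet_of_mem_skewJulia (skewMap_mem_skewJulia hf hx)

/-- If `f_k (J(f_a))` lies in the Fatou set for all `k ≠ a`, then an orbit in the skew Julia set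
that enters `J(f_a)` can only follow the letter `a`. -/
theorem eq_const_of_mem_juliaSingle (hf : ∀ j, Continuous (f j))
    (h_iii : ∀ j k, j ≠ k → f k '' juliaSingle (f j) ⊆ fatouSet (semigroupOf f)) {a : Fin m}
    (n : ℕ) : ∀ {x : (ℕ → Fin m) × Sphere}, x ∈ skewJulia f → x.2 ∈ juliaSingle (f a) →
      x.1 n = a := by
  have h0 : ∀ {x : (ℕ → Fin m) × Sphere}, x ∈ skewJulia f → x.2 ∈ juliaSingle (f a) →
      x.1 0 = a := fun {x} hx hxa => by
    by_contra hne
    exact apply_mem_juliaSet hf hx (h_iii a _ (Ne.symm hne) (mem_image_of_mem _ hxa))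
  induction n with
  | zero => exact h0
  | succ n ih =>
    intro x hx hxa
    refine ih (x := skewMap f x) (skewMap_mem_skewJulia hf hx) ?_
    change f (x.1 0) x.2 ∈ _
    rw [h0 hx hxa]
    exact map_juliaSingle hf hxa

/-- Under the combinatorial conditions on the overlaps, a point of the skew Julia set over an
overlap has a prescribed itinerary. -/
theorem eq_consConst_of_mem_overlap (hf : ∀ j, Continuous (f j)) (α : Fin m → Fin m → Fin m)
    (h_i : ∀ i j, i ≠ j → (overlap f i j).Nonempty →
      f i '' overlap f i j ⊆ juliaSingle (f (α i j)))
    (h_iii : ∀ j k, j ≠ k → f k '' juliaSingle (f j) ⊆ fatouSet (semigroupOf f))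
    {x : (ℕ → Fin m) × Sphere} (hx : x ∈ skewJulia f) {j : Fin m} (hj : x.1 0 ≠ j)
    (hz : x.2 ∈ overlap f (x.1 0) j) : x = (consConst (x.1 0) (α (x.1 0) j), x.2) := by
  refine Prod.ext (funext fun n => ?_) rfl
  cases n with
  | zero => rfl
  | succ n =>
    exact eq_const_of_mem_juliaSingle hf h_iii n (x := skewMap f x) (skewMap_mem_skewJulia hf hx)
      (h_i _ _ hj ⟨_, hz⟩ (mem_image_of_mem _ hz))

end Dynamics

/-! ### Covering and packing -/

theorem coverNum_mono {E : Type*} [PseudoMetricSpace E] {r : ℝ} {A B : Set E} (h : A ⊆ B) :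
    coverNum r A ≤ coverNum r B :=
  le_iInf₂ fun t ht => iInf₂_le t (h.trans ht)

theorem exists_finset_of_coverNum_le {E : Type*} [PseudoMetricSpace E] {r b : ℝ} {A : Set E}
    (h : (coverNum r A : ENNReal) ≤ ENNReal.ofReal b) :
    ∃ t : Finset E, A ⊆ ⋃ c ∈ t, Metric.ball c r ∧ (t.card : ENNReal) ≤ ENNReal.ofReal b := by
  have hlt : coverNum r A < ⊤ := by
    rw [lt_top_iff_ne_top]
    intro htop
    rw [htop] at h
    simp at h
  have hne : Nonempty {t : Finset E // A ⊆ ⋃ c ∈ t, Metric.ball c r} := by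
    obtain ⟨t, ht⟩ := iInf_lt_iff.1 hlt
    obtain ⟨ht, -⟩ := iInf_lt_iff.1 ht
    exact ⟨t, ht⟩
  have heq : coverNum r A =
      ⨅ t : {t : Finset E // A ⊆ ⋃ c ∈ t, Metric.ball c r}, (t.1.card : ℕ∞) := by
    rw [iInf_subtype]; rfl
  obtain ⟨t, ht⟩ := ciInf_mem
    fun t : {t : Finset E // A ⊆ ⋃ c ∈ t, Metric.ball c r} => (t.1.card : ℕ∞)
  refine ⟨t.1, t.2, ?_⟩
  rw [heq, ← ht] at h
  simpa using h

/-- A bound for the cardinality of `r`-separated subsets bounds the covering number, because a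
largest separated subset is an `r`-net. -/
theorem coverNum_le_of_separated {E : Type*} [PseudoMetricSpace E] {r b : ℝ} {A : Set E}
    (hr : 0 < r) (h : ∀ S : Finset E, (S : Set E) ⊆ A → (S : Set E).Pairwise (fun x y => r ≤ dist x y) →
      (S.card : ℝ) ≤ b) :
    (coverNum r A : ENNReal) ≤ ENNReal.ofReal b := by
  classical
  let P : ℕ → Prop := fun n => ∃ S : Finset E, (S : Set E) ⊆ A ∧
    (S : Set E).Pairwise (fun x y => r ≤ dist x y) ∧ S.card = n
  have hP0 : P 0 := ⟨∅, by simp, by simp, rfl⟩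
  have hPle : ∀ n, P n → n ≤ ⌊b⌋₊ := by
    rintro n ⟨S, hS, hsep, rfl⟩
    exact Nat.le_floor (h S hS hsep)
  obtain ⟨S, hS, hsep, hcard⟩ : P (Nat.findGreatest P ⌊b⌋₊) :=
    Nat.findGreatest_spec (Nat.zero_le _) hP0
  have hcov : A ⊆ ⋃ c ∈ S, Metric.ball c r := by
    intro x hx
    by_contra hnot
    simp only [mem_iUnion, Metric.mem_ball, not_exists, not_lt] at hnot
    have hxS : x ∉ S := fun hxS => by
      have := hnot x hxS
      rw [dist_self] at this
      linarith
    have hP : P (S.card + 1) := by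
      refine ⟨insert x S, ?_, ?_, Finset.card_insert_of_notMem hxS⟩
      · rw [Finset.coe_insert]
        exact insert_subset hx hS
      · rw [Finset.coe_insert]
        exact hsep.insert fun y hy _ => ⟨hnot y hy, by rw [dist_comm]; exact hnot y hy⟩
    have := Nat.le_findGreatest (hPle _ hP) hP
    omega
  refine le_trans (b := (S.card : ENNReal)) ?_ ?_
  · have : coverNum r A ≤ (S.card : ℕ∞) := iInf₂_le S hcov
    exact_mod_cast this
  · rw [← ENNReal.ofReal_natCast]
    exact ENNReal.ofReal_le_ofReal (h S hS hsep)

/-- Volume comparison for `2 ρ`-separated points of a polydisc. -/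
theorem card_mul_le_prod {ι T : Type*} [Fintype ι] {S : Finset T} {c : T → ι → ℂ} {a : ι → ℝ}
    {ρ : ℝ} (hρ : 0 < ρ) (ha : ∀ j, 0 ≤ a j) (hS : ∀ s ∈ S, ∀ j, ‖c s j‖ ≤ a j)
    (hsep : (S : Set T).Pairwise fun s t => 2 * ρ ≤ dist (c s) (c t)) :
    S.card * (ρ ^ 2) ^ Fintype.card ι ≤ ∏ j, (a j + ρ) ^ 2 := by
  have hball : ∀ (x : ℂ) {R : ℝ}, 0 ≤ R →
      (volume : Measure ℂ).real (Metric.ball x R) = R ^ 2 * Real.pi := by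
    intro x R hR
    rw [Measure.real, Complex.volume_ball, ENNReal.toReal_mul, ENNReal.toReal_pow,
      ENNReal.toReal_ofReal hR]
    rfl
  have hpoly : ∀ (x : ι → ℂ) (R : ι → ℝ), (∀ j, 0 ≤ R j) →
      (volume : Measure (ι → ℂ)).real (Set.pi univ fun j => Metric.ball (x j) (R j)) =
        ∏ j, (R j ^ 2 * Real.pi) := by
    intro x R hR
    rw [Measure.real, volume_pi_pi, ENNReal.toReal_prod]
    exact Finset.prod_congr rfl fun j _ => hball _ (hR j)
  have h1 : (volume : Measure (ι → ℂ)).real (⋃ s ∈ S, Metric.ball (c s) ρ) =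
      S.card * ∏ _j : ι, (ρ ^ 2 * Real.pi) := by
    rw [measureReal_biUnion_finset]
    · rw [Finset.sum_congr rfl fun s _ => by rw [ball_pi _ hρ, hpoly _ (fun _ => ρ) fun _ => hρ.le],
        Finset.sum_const, nsmul_eq_mul]
    · intro s hs t ht hst
      exact Metric.ball_disjoint_ball (by linarith [hsep hs ht hst])
    · exact fun s _ => measurableSet_ball
  have h2 : (volume : Measure (ι → ℂ)).real (⋃ s ∈ S, Metric.ball (c s) ρ) ≤
      (volume : Measure (ι → ℂ)).real (Set.pi univ fun j => Metric.ball (0 : ℂ) (a j + ρ)) := by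
    refine measureReal_mono ?_ ?_
    · intro w hw
      simp only [mem_iUnion, exists_prop] at hw
      obtain ⟨s, hs, hw⟩ := hw
      intro j _
      rw [mem_ball_zero_iff]
      have h3 : ‖w j - c s j‖ < ρ := by
        rw [← dist_eq_norm]
        exact (dist_le_pi_dist w (c s) j).trans_lt hw
      have h4 := norm_le_norm_add_norm_sub' (w j) (c s j)
      linarith [hS s hs j]
    · rw [volume_pi_pi]
      exact (ENNReal.prod_lt_top fun j _ => measure_ball_lt_top).ne
  rw [h1, hpoly (fun _ => 0) _ fun j => add_nonneg (ha j) hρ.le, Finset.prod_mul_distrib,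
    Finset.prod_mul_distrib, ← mul_assoc] at h2
  have := le_of_mul_le_mul_right h2 (Finset.prod_pos fun _ _ => Real.pi_pos)
  simpa using this

section Covering

variable {d : ℕ}

theorem finrank_real_euclideanSpace_complex (d : ℕ) :
    Module.finrank ℝ (EuclideanSpace ℂ (Fin d)) = 2 * d := by
  rw [finrank_real_of_complex, finrank_euclideanSpace_fin]

/-- If replacing the `k`-th coordinate by `g` contracts distances at most by the factor `L`, then the
`r`-neighbourhoods `{|g| ≤ c r}` of the zero set have the covering numbers of a set of real
codimension two. -/
theorem exists_coverNum_le_of_expanding (c : ℝ) (hc : 0 ≤ c) {L R : ℝ} (hL : 0 < L) (hR : 0 ≤ R)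
    (k : Fin d) :
    ∃ C : ℝ, 0 < C ∧ ∀ (B : Set (EuclideanSpace ℂ (Fin d))) (g : EuclideanSpace ℂ (Fin d) → ℂ),
      (∀ p ∈ B, ‖p‖ ≤ R) →
      (∀ p ∈ B, ∀ q ∈ B, dist p q ≤
        L * dist (Function.update (fun j => p j) k (g p)) (Function.update (fun j => q j) k (g q))) →
      ∀ r : ℝ, 0 < r → r < 4 → (coverNum r {p ∈ B | ‖g p‖ ≤ c * r} : ENNReal) ≤
        ENNReal.ofReal
          (C * r ^ ((2 : ℤ) - (Module.finrank ℝ (EuclideanSpace ℂ (Fin d)) : ℤ))) := by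
  -- the separation constant of the image, so that discs of radius `κ r` are disjoint
  set κ : ℝ := 1 / (2 * L) with hκ
  have hκ0 : 0 < κ := by positivity
  refine ⟨(c + κ) ^ 2 * ((R + 4 * κ) ^ 2) ^ (d - 1) / (κ ^ 2) ^ d, by positivity, ?_⟩
  intro B g hB hexp r hr hr4
  refine coverNum_le_of_separated hr fun S hS hsep => ?_
  have hpack := card_mul_le_prod (S := S) (ρ := κ * r)
    (c := fun p : EuclideanSpace ℂ (Fin d) => Function.update (fun j => p j) k (g p))
    (a := Function.update (fun _ => R) k (c * r)) (by positivity) ?_ ?_ ?_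
  · rw [Fintype.card_fin, ← Finset.mul_prod_erase _ _ (Finset.mem_univ k)] at hpack
    have hprod : ∏ j ∈ Finset.univ.erase k, (Function.update (fun _ => R) k (c * r) j + κ * r) ^ 2
        ≤ ((R + 4 * κ) ^ 2) ^ (d - 1) := by
      have hcard : (Finset.univ.erase k).card = d - 1 := by
        rw [Finset.card_erase_of_mem (Finset.mem_univ k), Finset.card_univ, Fintype.card_fin]
      rw [← hcard, ← Finset.prod_const]
      refine Finset.prod_le_prod (fun j _ => by positivity) fun j hj => ?_
      rw [Function.update_of_ne (Finset.ne_of_mem_erase hj)]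
      refine pow_le_pow_left₀ (by positivity) ?_ 2
      linarith [mul_lt_mul_of_pos_left hr4 hκ0]
    rw [finrank_real_euclideanSpace_complex, zpow_sub₀ hr.ne']
    rw [Function.update_self] at hpack
    have hrd : r ^ ((2 * d : ℕ) : ℤ) = (r ^ 2) ^ d := by
      rw [zpow_natCast, pow_mul]
    rw [hrd, div_mul_div_comm, le_div_iff₀ (by positivity)]
    calc (S.card : ℝ) * ((κ ^ 2) ^ d * (r ^ 2) ^ d) = S.card * ((κ * r) ^ 2) ^ d := by
          rw [mul_pow κ r, mul_pow (κ ^ 2)]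
      _ ≤ (c * r + κ * r) ^ 2 * ((R + 4 * κ) ^ 2) ^ (d - 1) :=
          hpack.trans (mul_le_mul_of_nonneg_left hprod (by positivity))
      _ = (c + κ) ^ 2 * ((R + 4 * κ) ^ 2) ^ (d - 1) * r ^ (2 : ℤ) := by
          rw [show r ^ (2 : ℤ) = r ^ 2 from zpow_ofNat r 2]; ring
  · intro j
    by_cases hj : j = k
    · subst hj; rw [Function.update_self]; positivity
    · rw [Function.update_of_ne hj]; exact hR
  · intro p hp j
    by_cases hj : j = k
    · subst hj; simpa only [Function.update_self] using (hS hp).2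
    · simp only [Function.update_of_ne hj]
      exact (PiLp.norm_apply_le p j).trans (hB p (hS hp).1)
  · intro p hp q hq hpq
    have h1 := (hsep hp hq hpq).trans (hexp p (hS hp).1 q (hS hq).1)
    have h2 : 2 * (κ * r) = r / L := by rw [hκ]; field_simp
    rw [h2, div_le_iff₀' hL]
    exact h1

/-! ### Uniform approximation by the linear part -/

theorem exists_single_ne_zero {D : EuclideanSpace ℂ (Fin d) →L[ℂ] ℂ} (hD : D ≠ 0) :
    ∃ k, D (EuclideanSpace.single k 1) ≠ 0 := by
  by_contra! h
  refine hD (ContinuousLinearMap.coe_injective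
    ((EuclideanSpace.basisFun (Fin d) ℂ).toBasis.ext fun k => ?_))
  simpa using h k

/-- Replacing the `k`-th coordinate by a linear form which is nonzero on the `k`-th basis vector
is an injective linear map, and a small perturbation of it still contracts distances at most by a
constant factor. -/
theorem exists_dist_le_mul_dist_update (D : EuclideanSpace ℂ (Fin d) →L[ℂ] ℂ) {k : Fin d}
    (hk : D (EuclideanSpace.single k 1) ≠ 0) :
    ∃ L ε : ℝ, 0 < L ∧ 0 < ε ∧ ∀ (g : EuclideanSpace ℂ (Fin d) → ℂ)
      (p q : EuclideanSpace ℂ (Fin d)), ‖g p - g q - D (p - q)‖ ≤ ε * ‖p - q‖ →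
      dist p q ≤ L * dist (Function.update (fun j => p j) k (g p))
        (Function.update (fun j => q j) k (g q)) := by
  let M : EuclideanSpace ℂ (Fin d) →ₗ[ℂ] (Fin d → ℂ) :=
    { toFun := fun v => Function.update (fun j => v j) k (D v)
      map_add' := fun v w => by
        ext j
        by_cases hj : j = k
        · subst hj; simp
        · simp [hj]
      map_smul' := fun a v => by
        ext j
        by_cases hj : j = k
        · subst hj; simp
        · simp [hj] }
  have hker : M.ker = ⊥ := by
    rw [LinearMap.ker_eq_bot']
    intro v hv
    have hvj : ∀ j, j ≠ k → v j = 0 := fun j hj => by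
      simpa [M, hj] using congrFun hv j
    have hDv : D v = 0 := by simpa [M] using congrFun hv k
    have hv' : v = v k • EuclideanSpace.single k (1 : ℂ) := by
      ext j
      by_cases hj : j = k
      · subst hj; simp
      · simp [hj, hvj j hj]
    rw [hv', map_smul, smul_eq_mul, mul_eq_zero] at hDv
    rw [hv', hDv.resolve_right hk, zero_smul]
  obtain ⟨K, hK, hM⟩ := M.exists_antilipschitzWith hker
  have hK' : (0 : ℝ) < K := hK
  refine ⟨2 * K, 1 / (2 * K), by positivity, by positivity, fun g p q h => ?_⟩
  have h1 : ‖p - q‖ ≤ K * ‖M (p - q)‖ := by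
    simpa [dist_eq_norm, ← map_sub] using hM.le_mul_dist p q
  set Φp := Function.update (fun j => p j) k (g p)
  set Φq := Function.update (fun j => q j) k (g q)
  have h2 : ‖M (p - q)‖ ≤ ‖Φp - Φq‖ + 1 / (2 * K) * ‖p - q‖ := by
    have h3 : ‖M (p - q) - (Φp - Φq)‖ ≤ 1 / (2 * K) * ‖p - q‖ := by
      refine (pi_norm_le_iff_of_nonneg (by positivity)).2 fun j => ?_
      by_cases hj : j = k
      · subst hj
        have : (M (p - q) - (Φp - Φq)) j = -(g p - g q - D (p - q)) := by
          simp [M, Φp, Φq]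
        rw [this, norm_neg]
        exact h
      · have : (M (p - q) - (Φp - Φq)) j = 0 := by
          simp [M, Φp, Φq, hj]
        rw [this, norm_zero]
        positivity
    have := norm_le_norm_add_norm_sub' (M (p - q)) (Φp - Φq)
    linarith
  have h4 : (K : ℝ) * (1 / (2 * K) * ‖p - q‖) = ‖p - q‖ / 2 := by field_simp
  have h5 := mul_le_mul_of_nonneg_left h2 hK'.le
  rw [mul_add, h4] at h5
  rw [dist_eq_norm, dist_eq_norm]
  linarith

theorem exists_ball_eventually_dist_le {X : Type*} [TopologicalSpace X] {E : Type*}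
    [NormedAddCommGroup E] [ProperSpace E] {K : Set X} {U : Set E} {p₀ : E} {g : X → E → ℂ}
    (hU : IsOpen U) (hp₀ : p₀ ∈ U)
    (hcont : ContinuousOn (Function.uncurry g) (K ×ˢ U)) {x₀ : X} (hx₀ : x₀ ∈ K) {ε : ℝ}
    (hε : 0 < ε) : ∃ δ > 0, Metric.ball p₀ δ ⊆ U ∧
      ∀ᶠ x in 𝓝[K] x₀, ∀ p ∈ Metric.ball p₀ δ, dist (g x p) (g x₀ p) < ε := by
  obtain ⟨δ, hδ, hδU⟩ := Metric.nhds_basis_closedBall.mem_iff.1 (hU.mem_nhds hp₀)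
  refine ⟨δ, hδ, Metric.ball_subset_closedBall.trans hδU, ?_⟩
  obtain ⟨v, hv, h⟩ := (isCompact_closedBall p₀ δ).mem_uniformity_of_prod
    (hcont.mono (prod_mono_right hδU)) hx₀ (Metric.dist_mem_uniformity hε)
  exact mem_of_superset hv fun x hx p hp => h x hx p (Metric.ball_subset_closedBall hp)

section Family

variable {X : Type*} [TopologicalSpace X] {E : Type*} [NormedAddCommGroup E] [NormedSpace ℂ E]
  [ProperSpace E] {K : Set X} {U : Set E} {p₀ : E} {g : X → E → ℂ}

/-- In a continuous family of holomorphic functions, the derivatives depend continuously on the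
function and the point, by the Cauchy estimate. -/
theorem exists_ball_eventually_fderiv_sub_le (hU : IsOpen U) (hp₀ : p₀ ∈ U)
    (hcont : ContinuousOn (Function.uncurry g) (K ×ˢ U))
    (hg : ∀ x ∈ K, ∀ p ∈ U, AnalyticAt ℂ (g x) p) {x₀ : X} (hx₀ : x₀ ∈ K) {ε : ℝ}
    (hε : 0 < ε) : ∃ δ > 0, Metric.ball p₀ δ ⊆ U ∧
      ∀ᶠ x in 𝓝[K] x₀, ∀ p ∈ Metric.ball p₀ δ,
        ‖fderiv ℂ (g x) p - fderiv ℂ (g x₀) p₀‖ ≤ ε := by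
  have hfd : ∀ᶠ p in 𝓝 p₀, ‖fderiv ℂ (g x₀) p - fderiv ℂ (g x₀) p₀‖ < ε / 2 := by
    have := (hg x₀ hx₀ p₀ hp₀).fderiv.continuousAt
    simpa [dist_eq_norm] using this.eventually (Metric.ball_mem_nhds _ (half_pos hε))
  obtain ⟨δ, hδ, hδ'⟩ := Metric.nhds_basis_closedBall.mem_iff.1 (hfd.and (hU.mem_nhds hp₀))
  have hδU : Metric.closedBall p₀ δ ⊆ U := fun p hp => (hδ' hp).2
  have hball : Metric.ball p₀ (δ / 2) ⊆ Metric.closedBall p₀ δ :=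
    (Metric.ball_subset_ball (by linarith)).trans Metric.ball_subset_closedBall
  refine ⟨δ / 2, by positivity, hball.trans hδU, ?_⟩
  obtain ⟨v, hv, h⟩ := (isCompact_closedBall p₀ δ).mem_uniformity_of_prod
    (hcont.mono (prod_mono_right hδU)) hx₀
    (Metric.dist_mem_uniformity (show 0 < ε * δ / 8 by positivity))
  filter_upwards [hv, self_mem_nhdsWithin] with x hx hxK p hp
  have hsub : Metric.ball p (δ / 2) ⊆ Metric.closedBall p₀ δ := fun q hq => by
    rw [Metric.mem_ball] at hq hp
    rw [Metric.mem_closedBall]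
    linarith [dist_triangle q p p₀]
  have hclose : ∀ q ∈ Metric.closedBall p₀ δ, ‖g x q - g x₀ q‖ < ε * δ / 8 := fun q hq => by
    rw [← dist_eq_norm]; exact h x hx q hq
  have hpc := hball hp
  have hdiff : ∀ q ∈ Metric.closedBall p₀ δ, DifferentiableAt ℂ (fun q => g x q - g x₀ q) q :=
    fun q hq => (hg x hxK q (hδU hq)).differentiableAt.sub
      (hg x₀ hx₀ q (hδU hq)).differentiableAt
  have hcauchy : ‖fderiv ℂ (fun q => g x q - g x₀ q) p‖ ≤ (ε * δ / 4) / (δ / 2) := by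
    refine Complex.norm_fderiv_le_div_of_mapsTo_ball
      (fun q hq => (hdiff q (hsub hq)).differentiableWithinAt) (fun q hq => ?_) (by positivity)
    rw [mem_closedBall_iff_norm]
    have := norm_sub_le (g x q - g x₀ q) (g x p - g x₀ p)
    linarith [hclose q (hsub hq), hclose p hpc]
  rw [fderiv_fun_sub (hg x hxK p (hδU hpc)).differentiableAt
    (hg x₀ hx₀ p (hδU hpc)).differentiableAt,
    show ε * δ / 4 / (δ / 2) = ε / 2 by field_simp; norm_num] at hcauchy
  have h1 := (hδ' hpc).1
  have h2 := norm_sub_le_norm_sub_add_norm_sub (fderiv ℂ (g x) p) (fderiv ℂ (g x₀) p)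
    (fderiv ℂ (g x₀) p₀)
  linarith

end Family

/-! ### Uniform transversality near the base point -/

theorem exists_coverNum_le_nat {E : Type*} [PseudoMetricSpace E] {ε : ℝ} (hε : 0 < ε) {A : Set E}
    (hA : TotallyBounded A) : ∃ N : ℕ, ∀ r, ε ≤ r → coverNum r A ≤ N := by
  obtain ⟨t, ht, hcov⟩ := Metric.totallyBounded_iff.1 hA ε hε
  refine ⟨ht.toFinset.card, fun r hr => iInf₂_le ht.toFinset (hcov.trans ?_)⟩
  simp only [Finite.mem_toFinset]
  exact iUnion₂_mono fun c _ => Metric.ball_subset_ball hr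

/-- A family `g` of functions is transversal on `B` for the functions in `S`: zeros are
nondegenerate, and the sets `{|g| ≤ c r}` have covering numbers `O(r ^ (2 - 2 d))`. -/
def TransversalOn {X : Type*} (g : X → EuclideanSpace ℂ (Fin d) → ℂ) (c : ℝ) (S : Set X)
    (B : Set (EuclideanSpace ℂ (Fin d))) : Prop :=
  (∀ x ∈ S, ∀ p ∈ B, g x p = 0 → fderiv ℂ (g x) p ≠ 0) ∧
    ∃ C : ℝ, 0 < C ∧ ∀ x ∈ S, ∀ r : ℝ, 0 < r → r < 4 →
      (coverNum r {p ∈ B | ‖g x p‖ ≤ c * r} : ENNReal) ≤ ENNReal.ofReal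
        (C * r ^ ((2 : ℤ) - (Module.finrank ℝ (EuclideanSpace ℂ (Fin d)) : ℤ)))

theorem TransversalOn.mono {X : Type*} {g : X → EuclideanSpace ℂ (Fin d) → ℂ} {c : ℝ}
    {S S' : Set X} {B B' : Set (EuclideanSpace ℂ (Fin d))} (h : TransversalOn g c S B)
    (hS : S' ⊆ S) (hB : B' ⊆ B) : TransversalOn g c S' B' := by
  obtain ⟨h1, C, hC, h2⟩ := h
  refine ⟨fun x hx p hp => h1 x (hS hx) p (hB hp), C, hC, fun x hx r hr hr4 =>
    le_trans ?_ (h2 x (hS hx) r hr hr4)⟩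
  have : coverNum r {p ∈ B' | ‖g x p‖ ≤ c * r} ≤ coverNum r {p ∈ B | ‖g x p‖ ≤ c * r} :=
    coverNum_mono fun p hp => ⟨hB hp.1, hp.2⟩
  exact_mod_cast this

theorem TransversalOn.union {X : Type*} {g : X → EuclideanSpace ℂ (Fin d) → ℂ} {c : ℝ}
    {S S' : Set X} {B : Set (EuclideanSpace ℂ (Fin d))} (h : TransversalOn g c S B)
    (h' : TransversalOn g c S' B) : TransversalOn g c (S ∪ S') B := by
  obtain ⟨h1, C, hC, h2⟩ := h
  obtain ⟨h1', C', hC', h2'⟩ := h'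
  refine ⟨fun x hx => hx.elim (h1 x) (h1' x), max C C', lt_max_of_lt_left hC,
    fun x hx r hr hr4 => ?_⟩
  have hpow := zpow_nonneg hr.le
    ((2 : ℤ) - (Module.finrank ℝ (EuclideanSpace ℂ (Fin d)) : ℤ))
  rcases hx with hx | hx
  · exact (h2 x hx r hr hr4).trans
      (ENNReal.ofReal_le_ofReal (mul_le_mul_of_nonneg_right (le_max_left _ _) hpow))
  · exact (h2' x hx r hr hr4).trans
      (ENNReal.ofReal_le_ofReal (mul_le_mul_of_nonneg_right (le_max_right _ _) hpow))

section Transversal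

variable {X : Type*} [TopologicalSpace X] {K : Set X} {U : Set (EuclideanSpace ℂ (Fin d))}
  {p₀ : EuclideanSpace ℂ (Fin d)} {g : X → EuclideanSpace ℂ (Fin d) → ℂ}

theorem exists_transversalOn_of_ne_zero (hd : 1 ≤ d) (hU : IsOpen U) (hp₀ : p₀ ∈ U)
    (hcont : ContinuousOn (Function.uncurry g) (K ×ˢ U))
    (hg : ∀ x ∈ K, ∀ p ∈ U, AnalyticAt ℂ (g x) p) {c : ℝ} (hc : 0 < c) {x₀ : X} (hx₀ : x₀ ∈ K)
    (hne : g x₀ p₀ ≠ 0) :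
    ∃ S ∈ 𝓝[K] x₀, ∃ δ > 0, TransversalOn g c S (Metric.ball p₀ δ) := by
  set ε := ‖g x₀ p₀‖ / 3 with hε
  have hε0 : 0 < ε := by positivity
  obtain ⟨δ₁, hδ₁, -, hS⟩ := exists_ball_eventually_dist_le hU hp₀ hcont hx₀ hε0
  obtain ⟨δ₂, hδ₂, hball⟩ := Metric.continuousAt_iff.1 (hg x₀ hx₀ p₀ hp₀).continuousAt ε hε0
  have hlow : ∀ x ∈ {x | ∀ p ∈ Metric.ball p₀ δ₁, dist (g x p) (g x₀ p) < ε},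
      ∀ p ∈ Metric.ball p₀ (min δ₁ δ₂), ε < ‖g x p‖ := by
    intro x hx p hp
    have h1 := hx p (Metric.ball_subset_ball (min_le_left _ _) hp)
    have h2 := hball (Metric.ball_subset_ball (min_le_right _ _) hp)
    have h3 := dist_triangle_left (g x p) (g x₀ p₀) (g x₀ p)
    have h4 := norm_le_norm_add_norm_sub (g x p) (g x₀ p₀)
    rw [← dist_eq_norm] at h4
    rw [dist_comm (g x₀ p) (g x p)] at h3
    linarith
  obtain ⟨N, hN⟩ := exists_coverNum_le_nat (div_pos hε0 hc)
    ((isCompact_closedBall p₀ (min δ₁ δ₂)).totallyBounded.subset Metric.ball_subset_closedBall)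
  refine ⟨_, hS, min δ₁ δ₂, lt_min hδ₁ hδ₂, ?_, (N + 1) * 4 ^ (2 * d - 2), by positivity, ?_⟩
  · intro x hx p hp h0
    have := hlow x hx p hp
    rw [h0, norm_zero] at this
    linarith
  · intro x hx r hr hr4
    rcases lt_or_ge r (ε / c) with hrε | hrε
    · -- the values of the functions are too large for such `r`
      have hempty : {p ∈ Metric.ball p₀ (min δ₁ δ₂) | ‖g x p‖ ≤ c * r} = ∅ := by
        refine eq_empty_of_forall_notMem fun p hp => ?_
        rw [lt_div_iff₀' hc] at hrε
        linarith [hlow x hx p hp.1, hp.2]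
      have h0 : coverNum r (∅ : Set (EuclideanSpace ℂ (Fin d))) ≤ (0 : ℕ) :=
        iInf₂_le (∅ : Finset _) (empty_subset _)
      rw [hempty, le_antisymm h0 (zero_le)]
      simp
    · have h1 : coverNum r {p ∈ Metric.ball p₀ (min δ₁ δ₂) | ‖g x p‖ ≤ c * r} ≤ N :=
        (coverNum_mono (sep_subset _ _)).trans (hN r hrε)
      have h2 : (coverNum r {p ∈ Metric.ball p₀ (min δ₁ δ₂) | ‖g x p‖ ≤ c * r} : ENNReal) ≤
          ENNReal.ofReal N := by
        rw [ENNReal.ofReal_natCast]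
        exact_mod_cast h1
      refine h2.trans (ENNReal.ofReal_le_ofReal ?_)
      have hexp : (2 : ℤ) - (Module.finrank ℝ (EuclideanSpace ℂ (Fin d)) : ℤ) =
          -((2 * d - 2 : ℕ) : ℤ) := by
        rw [finrank_real_euclideanSpace_complex]
        omega
      rw [hexp, zpow_neg, zpow_natCast, mul_assoc, ← div_eq_mul_inv, ← div_pow]
      have h3 : (1 : ℝ) ≤ (4 / r) ^ (2 * d - 2) :=
        one_le_pow₀ ((one_le_div hr).2 hr4.le)
      nlinarith [(Nat.cast_nonneg N : (0 : ℝ) ≤ N)]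

theorem exists_transversalOn_of_fderiv_ne_zero (hU : IsOpen U) (hp₀ : p₀ ∈ U)
    (hcont : ContinuousOn (Function.uncurry g) (K ×ˢ U))
    (hg : ∀ x ∈ K, ∀ p ∈ U, AnalyticAt ℂ (g x) p) {c : ℝ} (hc : 0 < c) {x₀ : X} (hx₀ : x₀ ∈ K)
    (hne : fderiv ℂ (g x₀) p₀ ≠ 0) :
    ∃ S ∈ 𝓝[K] x₀, ∃ δ > 0, TransversalOn g c S (Metric.ball p₀ δ) := by
  obtain ⟨k, hk⟩ := exists_single_ne_zero hne
  obtain ⟨L, ε, hL, hε, hexp⟩ := exists_dist_le_mul_dist_update _ hk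
  have hε' : 0 < min ε (‖fderiv ℂ (g x₀) p₀‖ / 2) := lt_min hε (by positivity)
  obtain ⟨δ, hδ, hδU, hS⟩ := exists_ball_eventually_fderiv_sub_le hU hp₀ hcont hg hx₀ hε'
  obtain ⟨C, hC, hcov⟩ := exists_coverNum_le_of_expanding c hc.le (R := ‖p₀‖ + δ) hL
    (by positivity) k
  refine ⟨_, inter_mem hS self_mem_nhdsWithin, δ, hδ, ?_, C, hC, ?_⟩
  · rintro x ⟨hx, -⟩ p hp - h0
    have h1 := (hx p hp).trans (min_le_right _ _)
    rw [h0, zero_sub, norm_neg] at h1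
    have : 0 < ‖fderiv ℂ (g x₀) p₀‖ := norm_pos_iff.2 hne
    linarith
  · rintro x ⟨hx, hxK⟩ r hr hr4
    refine hcov _ (g x) (fun p hp => ?_) (fun p hp q hq => hexp (g x) p q ?_) r hr hr4
    · have := norm_le_norm_add_norm_sub' p p₀
      rw [mem_ball_iff_norm] at hp
      linarith
    · exact (convex_ball p₀ δ).norm_image_sub_le_of_norm_fderiv_le'
        (fun q hq => (hg x hxK q (hδU hq)).differentiableAt)
        (fun q hq => (hx q hq).trans (min_le_left _ _)) hq hp

/-- In a compact continuous family of holomorphic functions, nondegeneracy of the zeros at `p₀`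
gives uniform transversality near `p₀`. -/
theorem exists_transversalOn (hd : 1 ≤ d) (hK : IsCompact K) (hU : IsOpen U) (hp₀ : p₀ ∈ U)
    (hcont : ContinuousOn (Function.uncurry g) (K ×ˢ U))
    (hg : ∀ x ∈ K, ∀ p ∈ U, AnalyticAt ℂ (g x) p)
    (hzero : ∀ x ∈ K, g x p₀ = 0 → fderiv ℂ (g x) p₀ ≠ 0) {c : ℝ} (hc : 0 < c) :
    ∃ δ > 0, TransversalOn g c K (Metric.ball p₀ δ) := by
  refine hK.induction_on (p := fun S => ∃ δ > 0, TransversalOn g c S (Metric.ball p₀ δ)) ?_ ?_ ?_ ?_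
  · exact ⟨1, one_pos, fun x hx => hx.elim, 1, one_pos, fun x hx => hx.elim⟩
  · rintro S T hST ⟨δ, hδ, h⟩
    exact ⟨δ, hδ, h.mono hST Subset.rfl⟩
  · rintro S T ⟨δ, hδ, h⟩ ⟨δ', hδ', h'⟩
    exact ⟨min δ δ', lt_min hδ hδ',
      (h.mono Subset.rfl (Metric.ball_subset_ball (min_le_left _ _))).union
        (h'.mono Subset.rfl (Metric.ball_subset_ball (min_le_right _ _)))⟩
  · intro x hx
    by_cases h0 : g x p₀ = 0
    · exact exists_transversalOn_of_fderiv_ne_zero hU hp₀ hcont hg hc hx (hzero x hx h0)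
    · exact exists_transversalOn_of_ne_zero hd hU hp₀ hcont hg hc hx h0

end Transversal

end Covering

/-! ### The spherical distance on bounded sets -/

theorem norm_sub_le_of_sphDist_le {z w : ℂ} {R r : ℝ} (hz : ‖z‖ ≤ R) (hw : ‖w‖ ≤ R)
    (h : sphDist (z : Sphere) (w : Sphere) ≤ r) : ‖z - w‖ ≤ (1 + R ^ 2) / 2 * r := by
  set t := halfChord (z : Sphere) (w : Sphere) with ht
  have htdef : t = ‖z - w‖ / (√(1 + ‖z‖ ^ 2) * √(1 + ‖w‖ ^ 2)) := rfl
  have hpos : 0 < √(1 + ‖z‖ ^ 2) * √(1 + ‖w‖ ^ 2) := by positivity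
  have ht0 : 0 ≤ t := by rw [htdef]; positivity
  have ht1 : t ≤ 1 := by
    rw [htdef, div_le_one hpos, ← Real.sqrt_mul (by positivity)]
    refine Real.le_sqrt_of_sq_le ?_
    nlinarith [norm_sub_le z w, norm_nonneg (z - w), sq_nonneg (1 - ‖z‖ * ‖w‖)]
  have hta : t ≤ r / 2 := by
    have h1 := Real.sin_le (Real.arcsin_nonneg.2 ht0)
    rw [Real.sin_arcsin (by linarith) ht1] at h1
    have h2 : 2 * Real.arcsin t ≤ r := h
    linarith
  have hle : √(1 + ‖z‖ ^ 2) * √(1 + ‖w‖ ^ 2) ≤ 1 + R ^ 2 := by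
    calc √(1 + ‖z‖ ^ 2) * √(1 + ‖w‖ ^ 2) ≤ √(1 + R ^ 2) * √(1 + R ^ 2) := by gcongr
      _ = 1 + R ^ 2 := Real.mul_self_sqrt (by positivity)
  calc ‖z - w‖ = t * (√(1 + ‖z‖ ^ 2) * √(1 + ‖w‖ ^ 2)) := by rw [htdef]; field_simp
    _ ≤ r / 2 * (1 + R ^ 2) := mul_le_mul hta hle hpos.le (ht0.trans hta)
    _ = (1 + R ^ 2) / 2 * r := by ring

/-! ### Transversality conditions -/

/-- The strong transversality condition implies the transversality condition, since a ball of
radius `r` has volume `O(r ^ D)`. -/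
theorem StrongTransversalityCondition.transversalityCondition {E : Type*} [NormedAddCommGroup E]
    [NormedSpace ℝ E] [FiniteDimensional ℝ E] [MeasureSpace E] [BorelSpace E]
    [(volume : Measure E).IsAddHaarMeasure] {m : ℕ} {U : Set E} {p₀ : E}
    {f : E → Fin m → Sphere → Sphere} {hbar : E → (ℕ → Fin m) → Sphere → Sphere}
    (h : StrongTransversalityCondition U p₀ f hbar) : TransversalityCondition U p₀ f hbar := by
  obtain ⟨C, hC, h⟩ := h
  set V := (volume : Measure E).real (Metric.ball 0 1) with hV
  have hVtop : (volume : Measure E) (Metric.ball 0 1) ≠ ⊤ := measure_ball_lt_top.ne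
  have hVpos : 0 < V :=
    ENNReal.toReal_pos (Metric.measure_ball_pos _ _ one_pos).ne' hVtop
  refine ⟨C * V, by positivity, fun r hr hrd x hx y hy hxy => ?_⟩
  obtain ⟨t, ht, hcard⟩ := exists_finset_of_coverNum_le (h r hr hrd x hx y hy hxy)
  calc volume {p ∈ U | sphDist (hbar p x.1 x.2) (hbar p y.1 y.2) ≤ r}
      ≤ ∑ c ∈ t, volume (Metric.ball c r) :=
        (measure_mono ht).trans (measure_biUnion_finset_le t _)
    _ = t.card * ENNReal.ofReal (r ^ Module.finrank ℝ E * V) := by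
        rw [Finset.sum_congr rfl fun c _ => Measure.addHaar_ball_of_pos volume c hr,
          Finset.sum_const, nsmul_eq_mul, ENNReal.ofReal_mul (by positivity),
          hV, Measure.real, ENNReal.ofReal_toReal hVtop]
    _ ≤ ENNReal.ofReal (C * r ^ ((2 : ℤ) - (Module.finrank ℝ E : ℤ))) *
          ENNReal.ofReal (r ^ Module.finrank ℝ E * V) := by gcongr
    _ = ENNReal.ofReal (C * V * r ^ 2) := by
        rw [← ENNReal.ofReal_mul (by positivity), zpow_sub₀ hr.ne', zpow_natCast,
          show r ^ (2 : ℤ) = r ^ 2 from zpow_ofNat r 2]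
        congr 1
        field_simp

section Setting

variable {d m : ℕ} {U : Set (EuclideanSpace ℂ (Fin d))} {p₀ : EuclideanSpace ℂ (Fin d)}
  {f : EuclideanSpace ℂ (Fin d) → Fin m → Sphere → Sphere}
  {hbar : EuclideanSpace ℂ (Fin d) → (ℕ → Fin m) → Sphere → Sphere}

theorem HolomorphicSetting.mono (h : HolomorphicSetting U p₀ f hbar)
    {V : Set (EuclideanSpace ℂ (Fin d))} (hV : IsOpen V) (hVU : V ⊆ U) (hp₀ : p₀ ∈ V) :
    HolomorphicSetting V p₀ f hbar where
  isOpen := hV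
  isBounded := h.isBounded.subset hVU
  base_mem := hp₀
  mem_exp := fun p hp => h.mem_exp p (hVU hp)
  continuous_family := fun p hp j ε hε =>
    (h.continuous_family p (hVU hp) j ε hε).filter_mono (nhdsWithin_mono p hVU)
  homeo := fun p hp => h.homeo p (hVU hp)
  base_eq := h.base_eq
  conj := fun p hp => h.conj p (hVU hp)
  continuous_hbar := h.continuous_hbar.mono (prod_mono_right hVU)
  holomorphic_family := fun j p hp => h.holomorphic_family j p (hVU hp)
  holomorphic_hbar := fun x hx p hp => h.holomorphic_hbar x hx p (hVU hp)

theorem HolomorphicSetting.hbar_ne_infty (h : HolomorphicSetting U p₀ f hbar)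
    (hfin : ∀ p ∈ U, ∞ ∉ juliaSet (semigroupOf (f p))) {p : EuclideanSpace ℂ (Fin d)}
    (hp : p ∈ U) {x : (ℕ → Fin m) × Sphere} (hx : x ∈ skewJulia (f p₀)) :
    hbar p x.1 x.2 ≠ ∞ := by
  obtain ⟨H, hH⟩ := h.homeo p hp
  have hmem := snd_mem_juliaSet_of_mem_skewJulia (H ⟨x, hx⟩).2
  rw [hH] at hmem
  exact fun h0 => hfin p hp (h0 ▸ hmem)

theorem HolomorphicSetting.continuousOn_toC_hbar (h : HolomorphicSetting U p₀ f hbar)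
    (hfin : ∀ p ∈ U, ∞ ∉ juliaSet (semigroupOf (f p))) :
    ContinuousOn (fun y : ((ℕ → Fin m) × Sphere) × EuclideanSpace ℂ (Fin d) =>
      toC (hbar y.2 y.1.1 y.1.2)) (skewJulia (f p₀) ×ˢ U) := fun y hy =>
  (continuousAt_toC (h.hbar_ne_infty hfin hy.2 hy.1)).comp_continuousWithinAt
    (f := fun y : ((ℕ → Fin m) × Sphere) × EuclideanSpace ℂ (Fin d) => hbar y.2 y.1.1 y.1.2)
    (h.continuous_hbar y hy)

theorem HolomorphicSetting.analyticAt_hDiff (h : HolomorphicSetting U p₀ f hbar)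
    (hfin : ∀ p ∈ U, ∞ ∉ juliaSet (semigroupOf (f p))) {x y : (ℕ → Fin m) × Sphere}
    (hx : x ∈ skewJulia (f p₀)) (hy : y ∈ skewJulia (f p₀)) {p : EuclideanSpace ℂ (Fin d)}
    (hp : p ∈ U) : AnalyticAt ℂ (hDiff hbar x y) p :=
  ((h.holomorphic_hbar x hx p hp).analyticAt_toC (h.hbar_ne_infty hfin hp hx)).sub
    ((h.holomorphic_hbar y hy p hp).analyticAt_toC (h.hbar_ne_infty hfin hp hy))

/-- The pairs of points of the skew Julia set over sequences with different first letters. -/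
def separatedPairs (f : Fin m → Sphere → Sphere) :
    Set (((ℕ → Fin m) × Sphere) × ((ℕ → Fin m) × Sphere)) :=
  {q | q.1 ∈ skewJulia f ∧ q.2 ∈ skewJulia f ∧ q.1.1 0 ≠ q.2.1 0}

theorem isCompact_separatedPairs (f : Fin m → Sphere → Sphere) :
    IsCompact (separatedPairs f) := by
  refine IsClosed.isCompact ((isClosed_closure.preimage continuous_fst).inter
    ((isClosed_closure.preimage continuous_snd).inter ?_))
  exact (isClosed_discrete {a : Fin m × Fin m | a.1 ≠ a.2}).preimage
    (f := fun q : ((ℕ → Fin m) × Sphere) × ((ℕ → Fin m) × Sphere) => (q.1.1 0, q.2.1 0))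
    (by fun_prop)

/-- At the base parameter, two points of the skew Julia set with different first letters collide
only over an overlap, where their itineraries, and hence the gradient, are prescribed. -/
theorem HolomorphicSetting.fderiv_hDiff_ne_zero (h : HolomorphicSetting U p₀ f hbar)
    (hfin : ∀ p ∈ U, ∞ ∉ juliaSet (semigroupOf (f p))) (α : Fin m → Fin m → Fin m)
    (h_i : ∀ i j, i ≠ j → (overlap (f p₀) i j).Nonempty →
      f p₀ i '' overlap (f p₀) i j ⊆ juliaSingle (f p₀ (α i j)))
    (h_iii : ∀ j k, j ≠ k →
      f p₀ k '' juliaSingle (f p₀ j) ⊆ fatouSet (semigroupOf (f p₀)))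
    (h_iv : ∀ i j, i ≠ j → ∀ z ∈ overlap (f p₀) i j,
      grad (hDiff hbar (consConst i (α i j), z) (consConst j (α j i), z)) p₀ ≠ 0)
    {x y : (ℕ → Fin m) × Sphere} (hx : x ∈ skewJulia (f p₀)) (hy : y ∈ skewJulia (f p₀))
    (hxy : x.1 0 ≠ y.1 0) (h0 : hDiff hbar x y p₀ = 0) :
    fderiv ℂ (hDiff hbar x y) p₀ ≠ 0 := by
  have hp₀ := h.base_mem
  have hf := fun j => h.holomorphic_family.continuous hp₀ j
  have hz : x.2 = y.2 := by
    have h1 : toC (hbar p₀ x.1 x.2) = toC (hbar p₀ y.1 y.2) := sub_eq_zero.1 h0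
    rw [← h.base_eq x hx, ← h.base_eq y hy, ← coe_toC (h.hbar_ne_infty hfin hp₀ hx),
      ← coe_toC (h.hbar_ne_infty hfin hp₀ hy), h1]
  have hxo : x.2 ∈ overlap (f p₀) (x.1 0) (y.1 0) :=
    ⟨apply_mem_juliaSet hf hx, by rw [hz]; exact apply_mem_juliaSet hf hy⟩
  have hyo : y.2 ∈ overlap (f p₀) (y.1 0) (x.1 0) := by rw [← hz]; exact ⟨hxo.2, hxo.1⟩
  have hgrad := h_iv _ _ hxy _ hxo
  have hx' := eq_consConst_of_mem_overlap hf α h_i h_iii hx hxy hxo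
  have hy' := eq_consConst_of_mem_overlap hf α h_i h_iii hy hxy.symm hyo
  rw [← hx', hz, ← hy'] at hgrad
  intro hfd
  refine hgrad (funext fun k => ?_)
  rw [grad, hfd]
  rfl

end Setting

end RationalSemigroup

open RationalSemigroup
theorem lemma3p23 {d m : ℕ} (hd : 1 ≤ d) (U : Set (EuclideanSpace ℂ (Fin d)))
    (p₀ : EuclideanSpace ℂ (Fin d))
    (f : EuclideanSpace ℂ (Fin d) → Fin m → Sphere → Sphere)
    (hbar : EuclideanSpace ℂ (Fin d) → (ℕ → Fin m) → Sphere → Sphere)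
    (hset : HolomorphicSetting U p₀ f hbar)
    (hfin : ∀ p ∈ U, OnePoint.infty ∉ juliaSet (semigroupOf (f p)))
    (α : Fin m → Fin m → Fin m)
    (h_i : ∀ i j, i ≠ j → (overlap (f p₀) i j).Nonempty →
      f p₀ i '' overlap (f p₀) i j ⊆ juliaSingle (f p₀ (α i j)))
    (h_ii : ∀ i j k, i ≠ j → j ≠ k → i ≠ k →
      f p₀ k '' overlap (f p₀) i j ⊆ fatouSet (semigroupOf (f p₀)))
    (h_iii : ∀ j k, j ≠ k →
      f p₀ k '' juliaSingle (f p₀ j) ⊆ fatouSet (semigroupOf (f p₀)))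
    (h_iv : ∀ i j, i ≠ j → ∀ z ∈ overlap (f p₀) i j,
      grad (hDiff hbar (consConst i (α i j), z) (consConst j (α j i), z)) p₀ ≠ 0) :
    ∃ U₀ ⊆ U, IsOpen U₀ ∧ p₀ ∈ U₀ ∧
      HolomorphicSetting U₀ p₀ f hbar ∧
      AnalyticTransversalityCondition U₀ p₀ f hbar ∧
      StrongTransversalityCondition U₀ p₀ f hbar ∧
      TransversalityCondition U₀ p₀ f hbar := by
  have hU := hset.isOpen
  have hp₀ := hset.base_mem
  have hcont := hset.continuousOn_toC_hbar hfin
  -- on a compact ball of parameters the conjugates of the skew Julia set stay in a disc of radius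
  -- `R`, where the spherical and the Euclidean distance are comparable
  obtain ⟨δ₁, hδ₁, hδ₁U⟩ := Metric.nhds_basis_closedBall.mem_iff.1 (hU.mem_nhds hp₀)
  have hJ : IsCompact (skewJulia (f p₀)) := IsClosed.isCompact isClosed_closure
  obtain ⟨R, hR⟩ := (hJ.prod (isCompact_closedBall p₀ δ₁)).exists_bound_of_continuousOn
    (hcont.mono (Set.prod_mono_right hδ₁U))
  have hgcont : ContinuousOn
      (Function.uncurry fun q : ((ℕ → Fin m) × Sphere) × ((ℕ → Fin m) × Sphere) =>
        hDiff hbar q.1 q.2) (separatedPairs (f p₀) ×ˢ U) := by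
    refine ContinuousOn.sub ?_ ?_
    · exact hcont.comp (f := fun y : ((((ℕ → Fin m) × Sphere) × ((ℕ → Fin m) × Sphere)) ×
        EuclideanSpace ℂ (Fin d)) => (y.1.1, y.2)) (by fun_prop) fun y hy => ⟨hy.1.1, hy.2⟩
    · exact hcont.comp (f := fun y : ((((ℕ → Fin m) × Sphere) × ((ℕ → Fin m) × Sphere)) ×
        EuclideanSpace ℂ (Fin d)) => (y.1.2, y.2)) (by fun_prop) fun y hy => ⟨hy.1.2.1, hy.2⟩
  obtain ⟨δ₂, hδ₂, hT⟩ := exists_transversalOn (g := fun q => hDiff hbar q.1 q.2)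
    (c := (1 + R ^ 2) / 2) hd (isCompact_separatedPairs (f p₀)) hU hp₀ hgcont
    (fun q hq p hp => hset.analyticAt_hDiff hfin hq.1 hq.2.1 hp)
    (fun q hq h0 => hset.fderiv_hDiff_ne_zero hfin α h_i h_iii h_iv hq.1 hq.2.1 hq.2.2 h0)
    (by positivity)
  have hU₀ : Metric.ball p₀ (min δ₁ δ₂) ⊆ Metric.closedBall p₀ δ₁ :=
    (Metric.ball_subset_ball (min_le_left _ _)).trans Metric.ball_subset_closedBall
  have hp₀' : p₀ ∈ Metric.ball p₀ (min δ₁ δ₂) := Metric.mem_ball_self (lt_min hδ₁ hδ₂)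
  obtain ⟨hzero, C, hC, hcov⟩ :=
    hT.mono Set.Subset.rfl (Metric.ball_subset_ball (min_le_right δ₁ δ₂))
  have hstc : StrongTransversalityCondition (Metric.ball p₀ (min δ₁ δ₂)) p₀ f hbar := by
    refine ⟨C, hC, fun r hr hrd x hx y hy hxy => ?_⟩
    rw [sphereDiam_eq] at hrd
    refine le_trans ?_ (hcov (x, y) ⟨hx, hy, hxy⟩ r hr (hrd.trans Real.pi_lt_four))
    refine ENat.toENNReal_le.2 (coverNum_mono fun p hp => ⟨hp.1, ?_⟩)
    have hpU := hU₀ hp.1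
    refine norm_sub_le_of_sphDist_le (hR (x, p) ⟨hx, hpU⟩) (hR (y, p) ⟨hy, hpU⟩) ?_
    rw [coe_toC (hset.hbar_ne_infty hfin (hδ₁U hpU) hx),
      coe_toC (hset.hbar_ne_infty hfin (hδ₁U hpU) hy)]
    exact hp.2
  refine ⟨Metric.ball p₀ (min δ₁ δ₂), hU₀.trans hδ₁U, Metric.isOpen_ball, hp₀',
    hset.mono Metric.isOpen_ball (hU₀.trans hδ₁U) hp₀', ⟨fun p hp => hfin p (hδ₁U (hU₀ hp)), ?_⟩,
    hstc, hstc.transversalityCondition⟩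
  intro x hx y hy p hp h0 hxy hgrad
  obtain ⟨k, hk⟩ := exists_single_ne_zero (hzero (x, y) ⟨hx, hy, hxy⟩ p hp h0)
  exact hk (congrFun hgrad k)
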